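/- Let $A$ be an integral $m\times d$ matrix and let $\mathcal K=\{\mathbf r\in\mathbb R^d : A\mathbf r\le 0\}$ be the rational cone it defines. Assume that $\mathcal K$ is $d$-dimensional and pointed, i.e. that $\mathcal K$ contains no line. Let $\mathcal K^\circ$ be the (topological) interior of $\mathcal K$, and for $S\in\{\mathcal K,\mathcal K^\circ\}$ let $$\sigma_S(\mathbf x)=\sum_{\mathbf m\in S\cap\mathbb Z^d}\mathbf x^{\mathbf m},\qquad \mathbf x^{\mathbf m}=x_1^{m_1}\cdots x_d^{m_d},$$ a formal Laurent series. Then $\sigma_{\mathcal K}$ and $\sigma_{\mathcal K^\circ}$ each represent a unique rational function in $\mathbb C(x_1,\dots,x_d)$, where a formal series $f$ represents the rational function $F$ if there are Laurent polynomials $p$ and $q\neq 0$ with $q f=p$ and $F=p/q$; and, as rational functions, $$\sigma_{\mathcal K}(\mathbf x)=(-1)^d\,\sigma_{\mathcal K^\circ}(1/\mathbf x),\qquad 1/\mathbf x=(1/x_1,\dots,1/x_d).$$ -/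

import Mathlib

noncomputable section

namespace StanleyReciprocity

/-- The cone `{r ∈ ℝ^d : A r ≤ 0}` of an integral `m × d` matrix `A`. -/
def rationalCone {m d : ℕ} (A : Matrix (Fin m) (Fin d) ℤ) : Set (Fin d → ℝ) :=
  {r | ∀ i, ((A.map (Int.cast : ℤ → ℝ)).mulVec r) i ≤ 0}

/-- The set contains no (affine) line. -/
def ContainsNoLine {d : ℕ} (K : Set (Fin d → ℝ)) : Prop :=
  ¬ ∃ p v : Fin d → ℝ, v ≠ 0 ∧ ∀ t : ℝ, p + t • v ∈ K

/-- Laurent polynomials in `x_1, …, x_d` over `ℂ`: the exponent vector `m ∈ ℤ^d` corresponds to the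
monomial `x^m`. -/
abbrev Laurent (d : ℕ) : Type := AddMonoidAlgebra ℂ (Fin d → ℤ)

/-- The field `ℂ(x_1, …, x_d)` of rational functions, as the fraction field of the ring of
Laurent polynomials. -/
abbrev RationalFunction (d : ℕ) : Type := FractionRing (Laurent d)

/-- The substitution `x ↦ 1/x` on Laurent polynomials: `x^m ↦ x^(-m)`. -/
def Laurent.invVars (d : ℕ) : Laurent d ≃ₐ[ℂ] Laurent d :=
  AddMonoidAlgebra.domCongr ℂ ℂ (AddEquiv.neg (Fin d → ℤ))

/-- The substitution `x ↦ 1/x` on rational functions: `p(x)/q(x) ↦ p(1/x)/q(1/x)`. -/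
def RationalFunction.invVars (d : ℕ) : RationalFunction d ≃+* RationalFunction d :=
  IsFractionRing.ringEquivOfRingEquiv (Laurent.invVars d).toRingEquiv

/-- Formal (two-sided) Laurent series in `x_1, …, x_d`, given by their coefficients: the function
`f` stands for `∑_{m ∈ ℤ^d} f(m) x^m`. -/
abbrev FormalSeries (d : ℕ) : Type := (Fin d → ℤ) → ℂ

/-- The formal series `σ_S(x) = ∑_{m ∈ S ∩ ℤ^d} x^m` of the lattice points of a set `S ⊆ ℝ^d`. -/
def latticeSeries {d : ℕ} (S : Set (Fin d → ℝ)) : FormalSeries d :=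
  Set.indicator {m | (fun i => (m i : ℝ)) ∈ S} 1

/-- The product of a Laurent polynomial and a formal series; the coefficient of `x^m` is the finite
sum `∑_n q_n f(m - n)`. -/
def laurentMul {d : ℕ} (q : Laurent d) (f : FormalSeries d) : FormalSeries d :=
  fun m => q.coeff.sum fun n c => c * f (m - n)

/-- The formal series `f` is (the expansion of) the rational function `F`: there are Laurent
polynomials `p` and `q ≠ 0` with `q f = p` and `F = p / q`. -/
def IsExpansionOf {d : ℕ} (f : FormalSeries d) (F : RationalFunction d) : Prop :=
  ∃ p q : Laurent d, q ≠ 0 ∧ laurentMul q f = (fun m => p.coeff m) ∧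
    F = algebraMap (Laurent d) (RationalFunction d) p /
      algebraMap (Laurent d) (RationalFunction d) q

end StanleyReciprocity

end

/-!
Write `K` as the set of `r` with `a ⬝ r ≥ 0` for all `a` in a finite set `S` of nonzero integral
forms, and let `h a` be the series of the lattice points of the half-space `a ≥ 0`. For the
pointwise product of series, `σ_K = ∏_{a ∈ S} h a`, and the interior, reflected at the origin, has
the series `∏_{a ∈ S} (1 - h a)`. The claim is that these two series expand `F` and `(-1) ^ d F`.

A series with a nonzero period `u` is annihilated by `1 - x ^ u`, hence expands `0`. If `S` has a
common zero `u ≠ 0`, both series have period `u`. Otherwise `|S| ≥ d`. If `|S| = d`, any `d - 1` of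
the forms have a common zero, so expanding `∏ (1 - h a)` leaves only `(-1) ^ d ∏ h a` modulo series
that expand `0`; moreover a common zero `v a ≠ 0` of the forms other than `a` is a period of all
factors but `h a`, and `∏ (1 - x ^ (v a))` turns `∏ h a` into a Laurent polynomial.

If `|S| > d`, the forms satisfy a linear relation `∑ c a • a = 0`. As the forms in `S` are positive
at an interior point of `K`, both signs occur among the coefficients, so no point satisfies `a ≥ 0`
where `c a ≥ 0` and `a < 0` where `c a < 0`, or the reverse. Multiplied out, the vanishing of the
corresponding products expresses both series through proper subsets of `S` with the same
coefficients, and induction on `|S|` applies.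
-/

namespace StanleyReciprocity

section Expansion

variable {d : ℕ}

lemma laurentMul_zero_left (f : FormalSeries d) : laurentMul 0 f = 0 :=
  funext fun _ => by simp [laurentMul]

lemma laurentMul_add_left (p q : Laurent d) (f : FormalSeries d) :
    laurentMul (p + q) f = laurentMul p f + laurentMul q f := by
  ext m
  simp only [laurentMul, AddMonoidAlgebra.coeff_add, Pi.add_apply]
  exact Finsupp.sum_add_index' (by simp) (by intros; ring)

lemma laurentMul_add_right (q : Laurent d) (f g : FormalSeries d) :
    laurentMul q (f + g) = laurentMul q f + laurentMul q g := by
  ext m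
  simp [laurentMul, mul_add, Finsupp.sum_add]

lemma laurentMul_neg_right (q : Laurent d) (f : FormalSeries d) :
    laurentMul q (-f) = -laurentMul q f := by
  ext m
  simp [laurentMul, Finsupp.sum]

lemma laurentMul_single (n : Fin d → ℤ) (c : ℂ) (f : FormalSeries d) (m : Fin d → ℤ) :
    laurentMul (AddMonoidAlgebra.single n c) f m = c * f (m - n) := by
  simp [laurentMul]

lemma laurentMul_one (f : FormalSeries d) : laurentMul 1 f = f := by
  ext m
  simp [AddMonoidAlgebra.one_def, laurentMul_single]

lemma laurentMul_one_sub_single (u : Fin d → ℤ) (f : FormalSeries d) (m : Fin d → ℤ) :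
    laurentMul (1 - AddMonoidAlgebra.single u 1) f m = f m - f (m - u) := by
  rw [sub_eq_add_neg, ← AddMonoidAlgebra.single_neg, laurentMul_add_left, laurentMul_one,
    Pi.add_apply, laurentMul_single]
  ring

lemma laurentMul_mul (p q : Laurent d) (f : FormalSeries d) :
    laurentMul (p * q) f = laurentMul p (laurentMul q f) := by
  induction p using AddMonoidAlgebra.induction_linear with
  | zero => simp only [zero_mul, laurentMul_zero_left]
  | add p p' hp hp' => simp only [add_mul, laurentMul_add_left, hp, hp']
  | single n c =>
    induction q using AddMonoidAlgebra.induction_linear with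
    | zero =>
      ext m
      simp [laurentMul_zero_left, laurentMul_single]
    | add q q' hq hq' => simp only [mul_add, laurentMul_add_left, laurentMul_add_right, hq, hq']
    | single n' c' =>
      ext m
      simp [AddMonoidAlgebra.single_mul_single, laurentMul_single, mul_assoc, sub_sub]

lemma laurentMul_coeff (q p : Laurent d) : laurentMul q p.coeff = (q * p).coeff := by
  have laurentMul_delta (p : Laurent d) : laurentMul p (Pi.single 0 1) = p.coeff := by
    ext m
    induction p using AddMonoidAlgebra.induction_linear with
    | zero => simp [laurentMul_zero_left]
    | add p p' hp hp' => simp [laurentMul_add_left, hp, hp']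
    | single n c =>
      simp [laurentMul_single, Finsupp.single_apply, Pi.single_apply, sub_eq_zero, eq_comm]
  rw [← laurentMul_delta p, ← laurentMul_mul, laurentMul_delta]

lemma laurentMul_invVars_comp_neg (q : Laurent d) (f : FormalSeries d) :
    laurentMul (Laurent.invVars d q) (fun m => f (-m)) = fun m => laurentMul q f (-m) := by
  ext m
  induction q using AddMonoidAlgebra.induction_linear with
  | zero => simp [laurentMul_zero_left]
  | add p q hp hq => simp [laurentMul_add_left, hp, hq]
  | single n c => simp [Laurent.invVars, laurentMul_single, sub_eq_add_neg, add_comm]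

lemma Laurent.coeff_invVars (p : Laurent d) (m : Fin d → ℤ) :
    (Laurent.invVars d p).coeff m = p.coeff (-m) := by
  simp [Laurent.invVars]

lemma algebraMap_laurent_ne_zero {q : Laurent d} (hq : q ≠ 0) :
    algebraMap (Laurent d) (RationalFunction d) q ≠ 0 :=
  (map_ne_zero_iff _ (IsFractionRing.injective _ _)).2 hq

lemma IsExpansionOf.unique {f : FormalSeries d} {F F' : RationalFunction d}
    (h : IsExpansionOf f F) (h' : IsExpansionOf f F') : F = F' := by
  obtain ⟨p, q, hq, hf, rfl⟩ := h
  obtain ⟨p', q', hq', hf', rfl⟩ := h'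
  have cross_mul : p * q' = p' * q := by
    have h : laurentMul q' (laurentMul q f) = laurentMul q (laurentMul q' f) := by
      rw [← laurentMul_mul, ← laurentMul_mul, mul_comm]
    rw [hf, hf', laurentMul_coeff, laurentMul_coeff] at h
    rw [mul_comm p, mul_comm p']
    exact AddMonoidAlgebra.ext (DFunLike.coe_injective h)
  rw [div_eq_div_iff (algebraMap_laurent_ne_zero hq) (algebraMap_laurent_ne_zero hq'), ← map_mul,
    ← map_mul, cross_mul]

lemma isExpansionOf_zero : IsExpansionOf (0 : FormalSeries d) 0 :=
  ⟨0, 1, one_ne_zero, by rw [laurentMul_one]; rfl, by simp⟩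

lemma IsExpansionOf.add {f g : FormalSeries d} {F G : RationalFunction d}
    (hF : IsExpansionOf f F) (hG : IsExpansionOf g G) : IsExpansionOf (f + g) (F + G) := by
  obtain ⟨p, q, hq, hf, rfl⟩ := hF
  obtain ⟨p', q', hq', hg, rfl⟩ := hG
  refine ⟨p * q' + q * p', q * q', mul_ne_zero hq hq', ?_, ?_⟩
  · rw [laurentMul_add_right, laurentMul_mul q q' g, hg, mul_comm q q', laurentMul_mul, hf,
      laurentMul_coeff, laurentMul_coeff, mul_comm q' p]
    rfl
  · rw [div_add_div _ _ (algebraMap_laurent_ne_zero hq) (algebraMap_laurent_ne_zero hq')]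
    simp only [map_add, map_mul]

lemma IsExpansionOf.neg {f : FormalSeries d} {F : RationalFunction d} (h : IsExpansionOf f F) :
    IsExpansionOf (-f) (-F) := by
  obtain ⟨p, q, hq, hf, rfl⟩ := h
  refine ⟨-p, q, hq, by rw [laurentMul_neg_right, hf]; rfl, ?_⟩
  rw [map_neg]
  exact (neg_div _ _).symm

lemma IsExpansionOf.neg_one_pow_mul {f : FormalSeries d} {F : RationalFunction d}
    (h : IsExpansionOf f F) (k : ℕ) : IsExpansionOf ((-1) ^ k * f) ((-1) ^ k * F) := by
  obtain hk | hk := k.even_or_odd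
  · simpa only [hk.neg_one_pow, one_mul] using h
  · simpa only [hk.neg_one_pow, neg_one_mul] using h.neg

lemma IsExpansionOf.comp_neg {f : FormalSeries d} {F : RationalFunction d}
    (h : IsExpansionOf f F) :
    IsExpansionOf (fun m => f (-m)) (RationalFunction.invVars d F) := by
  obtain ⟨p, q, hq, hf, rfl⟩ := h
  refine ⟨Laurent.invVars d p, Laurent.invVars d q,
    (map_ne_zero_iff _ (Laurent.invVars d).injective).2 hq, ?_, by simp [RationalFunction.invVars]⟩
  simp only [laurentMul_invVars_comp_neg, hf, Laurent.coeff_invVars]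

lemma one_sub_single_ne_zero {u : Fin d → ℤ} (hu : u ≠ 0) :
    (1 - AddMonoidAlgebra.single u 1 : Laurent d) ≠ 0 := by
  rw [sub_ne_zero, AddMonoidAlgebra.one_def, Ne, AddMonoidAlgebra.single_left_inj one_ne_zero]
  exact hu.symm

lemma isExpansionOf_zero_of_periodic {f : FormalSeries d} {u : Fin d → ℤ} (hu : u ≠ 0)
    (hf : Function.Periodic f u) : IsExpansionOf f 0 := by
  refine ⟨0, 1 - AddMonoidAlgebra.single u 1, one_sub_single_ne_zero hu, ?_, by simp⟩
  ext m
  simp [laurentMul_one_sub_single, hf.sub_eq]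

lemma exists_isExpansionOf_of_finite_support {f : FormalSeries d} {q : Laurent d} (hq : q ≠ 0)
    (hf : (laurentMul q f).support.Finite) : ∃ F, IsExpansionOf f F :=
  ⟨_, AddMonoidAlgebra.ofCoeff (Finsupp.ofSupportFinite _ hf), q, hq, rfl, rfl⟩

/-- The series that expand the rational function `0`. They are the torsion elements of the
`Laurent d`-module of formal series. -/
def nullSeries (d : ℕ) : AddSubgroup (FormalSeries d) where
  carrier := {f | IsExpansionOf f 0}
  zero_mem' := isExpansionOf_zero
  add_mem' hf hg := by simpa only [add_zero, Set.mem_ofPred_eq] using IsExpansionOf.add hf hg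
  neg_mem' hf := by simpa only [neg_zero, Set.mem_ofPred_eq] using IsExpansionOf.neg hf

/-- The pairs `(f, g)` of series that expand `F` and `(-1) ^ d * F` for some rational function `F`.
Reciprocity for a cone `K` says that `(σ_K(x), σ_{K°}(1/x))` is such a pair. -/
def reciprocalPairs (d : ℕ) : AddSubgroup (FormalSeries d × FormalSeries d) where
  carrier := {p | ∃ F, IsExpansionOf p.1 F ∧ IsExpansionOf p.2 ((-1) ^ d * F)}
  zero_mem' := ⟨0, isExpansionOf_zero, by rw [mul_zero]; exact isExpansionOf_zero⟩
  add_mem' := by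
    rintro _ _ ⟨F, hF, hF'⟩ ⟨G, hG, hG'⟩
    exact ⟨F + G, hF.add hG, by rw [mul_add]; exact hF'.add hG'⟩
  neg_mem' := by
    rintro _ ⟨F, hF, hF'⟩
    exact ⟨-F, hF.neg, by rw [mul_neg]; exact hF'.neg⟩

end Expansion

section InclusionExclusion

variable {α R : Type*} [DecidableEq α] [CommRing R]

lemma prod_sdiff_mul_prod_one_sub (f : α → R) (s t : Finset α) :
    (∏ a ∈ s \ t, f a) * ∏ a ∈ t, (1 - f a) =
      ∑ u ∈ t.powerset, (-1) ^ u.card * ∏ a ∈ s \ t ∪ u, f a := by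
  rw [Finset.prod_sub, Finset.mul_sum]
  refine Finset.sum_congr rfl fun u hu => ?_
  have hdisj : Disjoint (s \ t) u :=
    Finset.sdiff_disjoint.mono_right (Finset.mem_powerset.1 hu)
  rw [Finset.prod_union hdisj, Finset.prod_const_one]
  ring

lemma prod_sdiff_mul_prod_one_sub_sub_mem (M : AddSubgroup R) (f : α → R) {s t : Finset α}
    (hts : t ⊆ s) (hM : ∀ u ⊂ s, ∏ a ∈ u, f a ∈ M) :
    (∏ a ∈ s \ t, f a) * ∏ a ∈ t, (1 - f a) - (-1) ^ t.card * ∏ a ∈ s, f a ∈ M := by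
  have hsum := Finset.sum_erase_eq_sub (f := fun u => (-1) ^ u.card * ∏ a ∈ s \ t ∪ u, f a)
    (Finset.mem_powerset_self t)
  rw [← prod_sdiff_mul_prod_one_sub f s t, Finset.sdiff_union_of_subset hts] at hsum
  rw [← hsum]
  refine sum_mem fun u hu => ?_
  obtain ⟨hne, hmem⟩ := Finset.mem_erase.1 hu
  have hut : u ⊆ t := Finset.mem_powerset.1 hmem
  have hssub : s \ t ∪ u ⊂ s := by
    obtain ⟨b, hb, hbu⟩ := Finset.exists_of_ssubset (hut.ssubset_of_ne hne)
    refine Finset.ssubset_iff_of_subset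
      (Finset.union_subset Finset.sdiff_subset (hut.trans hts)) |>.2 ⟨b, hts hb, ?_⟩
    simp [hb, hbu]
  obtain hk | hk := u.card.even_or_odd
  · simpa only [hk.neg_one_pow, one_mul] using hM _ hssub
  · simpa only [hk.neg_one_pow, neg_one_mul] using neg_mem (hM _ hssub)

lemma prod_mem_of_prod_sdiff_mul_prod_one_sub_eq_zero (M : AddSubgroup R) (f : α → R)
    {s t : Finset α} (hts : t ⊆ s) (hM : ∀ u ⊂ s, ∏ a ∈ u, f a ∈ M)
    (h : (∏ a ∈ s \ t, f a) * ∏ a ∈ t, (1 - f a) = 0) : ∏ a ∈ s, f a ∈ M := by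
  have hmem := prod_sdiff_mul_prod_one_sub_sub_mem M f hts hM
  rw [h, zero_sub, neg_mem_iff] at hmem
  obtain hk | hk := t.card.even_or_odd
  · simpa only [hk.neg_one_pow, one_mul] using hmem
  · simpa only [hk.neg_one_pow, neg_one_mul, neg_mem_iff] using hmem

end InclusionExclusion

section HalfSpace

variable {d : ℕ}

/-- The series of the lattice points of the half-space `a ≥ 0`. Products of series are taken
pointwise, so that they correspond to intersections of sets of lattice points. -/
noncomputable def halfSpaceSeries (a : Fin d → ℤ) : FormalSeries d :=
  {x | 0 ≤ a ⬝ᵥ x}.indicator 1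

lemma one_sub_halfSpaceSeries (a : Fin d → ℤ) :
    1 - halfSpaceSeries a = {x | a ⬝ᵥ x < 0}.indicator 1 := by
  rw [halfSpaceSeries, ← Set.indicator_compl]
  simp only [Set.compl_ofPred, not_le]

lemma prod_halfSpaceSeries (S : Finset (Fin d → ℤ)) :
    ∏ a ∈ S, halfSpaceSeries a = {x | ∀ a ∈ S, 0 ≤ a ⬝ᵥ x}.indicator 1 := by
  simp only [halfSpaceSeries, prod_indicator_const, one_pow, Set.ofPred_forall]

lemma prod_one_sub_halfSpaceSeries (S : Finset (Fin d → ℤ)) :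
    ∏ a ∈ S, (1 - halfSpaceSeries a) = {x | ∀ a ∈ S, a ⬝ᵥ x < 0}.indicator 1 := by
  simp only [one_sub_halfSpaceSeries, prod_indicator_const, one_pow, Set.ofPred_forall]

lemma periodic_halfSpaceSeries {a u : Fin d → ℤ} (h : a ⬝ᵥ u = 0) :
    Function.Periodic (halfSpaceSeries a) u := fun x => by
  simp [halfSpaceSeries, Set.indicator_apply, dotProduct_add, h]

lemma halfSpaceSeries_sub_eq_self {a u x : Fin d → ℤ} (h : |a ⬝ᵥ u| < |a ⬝ᵥ x|) :
    halfSpaceSeries a (x - u) = halfSpaceSeries a x := by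
  have hiff : a ⬝ᵥ u ≤ a ⬝ᵥ x ↔ 0 ≤ a ⬝ᵥ x := by
    grind
  simp [halfSpaceSeries, Set.indicator_apply, dotProduct_sub, hiff]

lemma injective_mulVecLin_of_coe {S : Finset (Fin d → ℤ)}
    (hker : ∀ u, (∀ a ∈ S, a ⬝ᵥ u = 0) → u = 0) :
    Function.Injective (Matrix.of ((↑) : S → Fin d → ℤ)).mulVecLin :=
  (injective_iff_map_eq_zero _).2 fun u hu => hker u fun a ha => congrFun hu ⟨a, ha⟩

lemma exists_ne_zero_forall_dotProduct_eq_zero {S : Finset (Fin d → ℤ)} (hS : S.card < d) :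
    ∃ u ≠ 0, ∀ a ∈ S, a ⬝ᵥ u = 0 := by
  by_contra! hker
  have hinj := injective_mulVecLin_of_coe (S := S) fun u hSu => by_contra fun hu =>
    let ⟨a, ha, hau⟩ := hker u hu
    hau (hSu a ha)
  have hfinrank := LinearMap.finrank_le_finrank_of_injective hinj
  simp only [Module.finrank_fintype_fun_eq_card, Fintype.card_fin, Fintype.card_coe] at hfinrank
  omega

lemma laurentMul_prod_one_sub_single_mul_prod {ι : Type*} {S : Finset ι} {v : ι → Fin d → ℤ}
    {f : ι → FormalSeries d} {g : FormalSeries d} (hg : ∀ i ∈ S, Function.Periodic g (v i))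
    (hf : ∀ i ∈ S, ∀ j ∈ S, j ≠ i → Function.Periodic (f j) (v i)) :
    laurentMul (∏ i ∈ S, (1 - AddMonoidAlgebra.single (v i) 1)) (g * ∏ i ∈ S, f i) =
      g * ∏ i ∈ S, laurentMul (1 - AddMonoidAlgebra.single (v i) 1) (f i) := by
  induction S using Finset.cons_induction generalizing g with
  | empty => simp [laurentMul_one]
  | cons k S hk ih =>
    simp only [Finset.forall_mem_cons] at hg hf
    have hS : Function.Periodic (∏ i ∈ S, f i) (v k) :=
      S.periodic_prod fun i hi => hf.1.2 i hi (by rintro rfl; exact hk hi)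
    have hstep : laurentMul (1 - AddMonoidAlgebra.single (v k) 1) (g * (f k * ∏ i ∈ S, f i)) =
        g * laurentMul (1 - AddMonoidAlgebra.single (v k) 1) (f k) * ∏ i ∈ S, f i := by
      ext m
      simp only [laurentMul_one_sub_single, Pi.mul_apply, hg.1.sub_eq, hS.sub_eq]
      ring
    have hk' (i) (hi : i ∈ S) : Function.Periodic
        (laurentMul (1 - AddMonoidAlgebra.single (v k) 1) (f k)) (v i) := fun m => by
      have hper := (hf.2 i hi).1 (by rintro rfl; exact hk hi)
      simp only [laurentMul_one_sub_single, hper m, add_sub_right_comm m, hper (m - v k)]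
    rw [Finset.prod_cons, Finset.prod_cons, Finset.prod_cons, mul_comm, laurentMul_mul, hstep,
      ih (fun i hi => (hg.2 i hi).mul (hk' i hi)) (fun i hi j hj => (hf.2 i hi).2 j hj), mul_assoc]

lemma finite_setOf_abs_dotProduct_le {S : Finset (Fin d → ℤ)}
    (hker : ∀ u, (∀ a ∈ S, a ⬝ᵥ u = 0) → u = 0) (n : (Fin d → ℤ) → ℤ) :
    {x | ∀ a ∈ S, |a ⬝ᵥ x| ≤ n a}.Finite := by
  refine Set.Finite.of_finite_image ((Set.finite_Icc (fun a : S => -n a) fun a => n a).subset ?_)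
    (injective_mulVecLin_of_coe hker).injOn
  rintro _ ⟨x, hx, rfl⟩
  exact ⟨fun a => (abs_le.1 (hx a a.2)).1, fun a => (abs_le.1 (hx a a.2)).2⟩

lemma exists_isExpansionOf_prod_halfSpaceSeries {S : Finset (Fin d → ℤ)} (hcard : S.card ≤ d)
    (hker : ∀ u, (∀ a ∈ S, a ⬝ᵥ u = 0) → u = 0) :
    ∃ F, IsExpansionOf (∏ a ∈ S, halfSpaceSeries a) F := by
  have hray (a) (ha : a ∈ S) : ∃ u ≠ 0, ∀ b ∈ S.erase a, b ⬝ᵥ u = 0 :=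
    exists_ne_zero_forall_dotProduct_eq_zero ((Finset.card_erase_lt_of_mem ha).trans_le hcard)
  choose! v hv0 hv using hray
  let q : Laurent d := ∏ a ∈ S, (1 - AddMonoidAlgebra.single (v a) 1)
  have hq : q ≠ 0 := Finset.prod_ne_zero_iff.2 fun a ha => one_sub_single_ne_zero (hv0 a ha)
  have hmul : laurentMul q (∏ a ∈ S, halfSpaceSeries a) =
      ∏ a ∈ S, laurentMul (1 - AddMonoidAlgebra.single (v a) 1) (halfSpaceSeries a) := by
    simpa only [one_mul] using laurentMul_prod_one_sub_single_mul_prod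
      (g := 1) (fun _ _ _ => rfl)
      fun a ha b hb hba => periodic_halfSpaceSeries (hv a ha b (Finset.mem_erase.2 ⟨hba, hb⟩))
  refine exists_isExpansionOf_of_finite_support hq
    ((finite_setOf_abs_dotProduct_le hker fun a => |a ⬝ᵥ v a|).subset fun x hx a ha => ?_)
  by_contra! hlt
  rw [Function.mem_support, hmul, Finset.prod_apply] at hx
  refine hx (Finset.prod_eq_zero ha ?_)
  rw [laurentMul_one_sub_single, halfSpaceSeries_sub_eq_self hlt, sub_self]

lemma prod_halfSpaceSeries_mem_nullSeries {S : Finset (Fin d → ℤ)} {u : Fin d → ℤ} (hu : u ≠ 0)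
    (hSu : ∀ a ∈ S, a ⬝ᵥ u = 0) : ∏ a ∈ S, halfSpaceSeries a ∈ nullSeries d :=
  isExpansionOf_zero_of_periodic hu
    (S.periodic_prod fun a ha => periodic_halfSpaceSeries (hSu a ha))

lemma prod_one_sub_halfSpaceSeries_mem_nullSeries {S : Finset (Fin d → ℤ)} {u : Fin d → ℤ}
    (hu : u ≠ 0) (hSu : ∀ a ∈ S, a ⬝ᵥ u = 0) :
    ∏ a ∈ S, (1 - halfSpaceSeries a) ∈ nullSeries d :=
  isExpansionOf_zero_of_periodic hu (S.periodic_prod fun a ha x => by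
    simp only [Pi.sub_apply, Pi.one_apply, periodic_halfSpaceSeries (hSu a ha) x])

lemma prod_halfSpaceSeries_mem_reciprocalPairs_of_card_le {S : Finset (Fin d → ℤ)}
    (hcard : S.card ≤ d) :
    (∏ a ∈ S, halfSpaceSeries a, ∏ a ∈ S, (1 - halfSpaceSeries a)) ∈ reciprocalPairs d := by
  by_cases hker : ∃ u ≠ 0, ∀ a ∈ S, a ⬝ᵥ u = 0
  · obtain ⟨u, hu, hSu⟩ := hker
    exact ⟨0, prod_halfSpaceSeries_mem_nullSeries hu hSu, by
      rw [mul_zero]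
      exact prod_one_sub_halfSpaceSeries_mem_nullSeries hu hSu⟩
  have hcard : S.card = d :=
    hcard.antisymm (not_lt.1 (mt exists_ne_zero_forall_dotProduct_eq_zero hker))
  obtain ⟨F, hF⟩ := exists_isExpansionOf_prod_halfSpaceSeries hcard.le fun u hSu =>
    by_contra fun hu => hker ⟨u, hu, hSu⟩
  have hnull : ∏ a ∈ S, (1 - halfSpaceSeries a) - (-1) ^ d * ∏ a ∈ S, halfSpaceSeries a ∈
      nullSeries d := by
    have hproper (T) (hT : T ⊂ S) : ∏ a ∈ T, halfSpaceSeries a ∈ nullSeries d := by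
      obtain ⟨u, hu, hTu⟩ :=
        exists_ne_zero_forall_dotProduct_eq_zero ((Finset.card_lt_card hT).trans_eq hcard)
      exact prod_halfSpaceSeries_mem_nullSeries hu hTu
    simpa [hcard] using
      prod_sdiff_mul_prod_one_sub_sub_mem (nullSeries d) halfSpaceSeries subset_rfl hproper
  exact ⟨F, hF, by simpa using IsExpansionOf.add hnull (hF.neg_one_pow_mul d)⟩

lemma prod_halfSpaceSeries_mul_prod_one_sub_eq_zero {P N : Finset (Fin d → ℤ)}
    {c : (Fin d → ℤ) → ℤ} (hc : ∑ a ∈ P, c a • a + ∑ a ∈ N, c a • a = 0) (hP : ∀ a ∈ P, 0 ≤ c a)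
    (hN : ∀ a ∈ N, c a ≤ 0) (hneg : ∃ a ∈ N, c a < 0) :
    (∏ a ∈ P, halfSpaceSeries a) * ∏ a ∈ N, (1 - halfSpaceSeries a) = 0 := by
  rw [prod_halfSpaceSeries, prod_one_sub_halfSpaceSeries, ← Set.inter_indicator_one]
  refine Set.indicator_eq_zero'.2 (Set.disjoint_right.2 fun x ⟨hxP, hxN⟩ _ => ?_)
  obtain ⟨b, hb, hcb⟩ := hneg
  have hsum : ∑ a ∈ P, c a * (a ⬝ᵥ x) + ∑ a ∈ N, c a * (a ⬝ᵥ x) = 0 := by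
    simpa only [add_dotProduct, sum_dotProduct, smul_dotProduct, smul_eq_mul, zero_dotProduct]
      using congrArg (· ⬝ᵥ x) hc
  have hsumP : 0 ≤ ∑ a ∈ P, c a * (a ⬝ᵥ x) :=
    Finset.sum_nonneg fun a ha => mul_nonneg (hP a ha) (hxP a ha)
  have hsumN : 0 < ∑ a ∈ N, c a * (a ⬝ᵥ x) :=
    Finset.sum_pos' (fun a ha => mul_nonneg_of_nonpos_of_nonpos (hN a ha) (hxN a ha).le)
      ⟨b, hb, mul_pos_of_neg_of_neg hcb (hxN b hb)⟩
  exact (add_pos_of_nonneg_of_pos hsumP hsumN).ne' hsum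

lemma exists_neg_of_sum_zsmul_eq_zero {V W : Type*} [AddCommGroup V] [AddCommGroup W]
    [LinearOrder W] [IsOrderedAddMonoid W] {S : Finset V} {ψ : V →+ W}
    (hψ : ∀ a ∈ S, 0 < ψ a) {c : V → ℤ} (hc : ∑ a ∈ S, c a • a = 0) (hne : ∃ a ∈ S, c a ≠ 0) :
    ∃ a ∈ S, c a < 0 := by
  by_contra! hnonneg
  obtain ⟨b, hb, hcb⟩ := hne
  have hsum : ∑ a ∈ S, c a • ψ a = 0 := by
    simpa only [map_sum, map_zsmul, map_zero] using congrArg ψ hc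
  have hpos : 0 < ∑ a ∈ S, c a • ψ a :=
    Finset.sum_pos' (fun a ha => zsmul_nonneg (hψ a ha).le (hnonneg a ha))
      ⟨b, hb, zsmul_pos (hψ b hb) ((hnonneg b hb).lt_of_ne' hcb)⟩
  exact hpos.ne' hsum

lemma prod_halfSpaceSeries_mem_of_sum_zsmul_eq_zero
    (M : AddSubgroup (FormalSeries d × FormalSeries d)) {S : Finset (Fin d → ℤ)}
    {c : (Fin d → ℤ) → ℤ} (hc : ∑ a ∈ S, c a • a = 0) (hneg : ∃ a ∈ S, c a < 0)
    (hpos : ∃ a ∈ S, 0 < c a)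
    (hM : ∀ T ⊂ S, (∏ a ∈ T, halfSpaceSeries a, ∏ a ∈ T, (1 - halfSpaceSeries a)) ∈ M) :
    (∏ a ∈ S, halfSpaceSeries a, ∏ a ∈ S, (1 - halfSpaceSeries a)) ∈ M := by
  let N := S.filter (c · < 0)
  have hcN (a) (ha : a ∈ N) : c a < 0 := (Finset.mem_filter.1 ha).2
  have hcP (a) (ha : a ∈ S \ N) : 0 ≤ c a := by
    simpa [N, (Finset.mem_sdiff.1 ha).1] using (Finset.mem_sdiff.1 ha).2
  have hNS : N ⊆ S := Finset.filter_subset _ _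
  have hcPN : ∑ a ∈ S \ N, c a • a + ∑ a ∈ N, c a • a = 0 := (Finset.sum_sdiff hNS).trans hc
  have hcNP : ∑ a ∈ N, (-c) a • a + ∑ a ∈ S \ N, (-c) a • a = 0 := by
    rw [add_comm]
    simpa only [Pi.neg_apply, neg_smul, Finset.sum_neg_distrib, ← neg_add, neg_eq_zero] using hcPN
  have hPN : (∏ a ∈ S \ N, halfSpaceSeries a) * ∏ a ∈ N, (1 - halfSpaceSeries a) = 0 := by
    obtain ⟨b, hb, hcb⟩ := hneg
    exact prod_halfSpaceSeries_mul_prod_one_sub_eq_zero hcPN hcP (fun a ha => (hcN a ha).le)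
      ⟨b, Finset.mem_filter.2 ⟨hb, hcb⟩, hcb⟩
  have hNP : (∏ a ∈ N, halfSpaceSeries a) * ∏ a ∈ S \ N, (1 - halfSpaceSeries a) = 0 := by
    obtain ⟨b, hb, hcb⟩ := hpos
    exact prod_halfSpaceSeries_mul_prod_one_sub_eq_zero hcNP
      (fun a ha => neg_nonneg.2 (hcN a ha).le) (fun a ha => neg_nonpos.2 (hcP a ha))
      ⟨b, Finset.mem_sdiff.2 ⟨hb, fun h => (hcN b h).not_gt hcb⟩, neg_neg_iff_pos.2 hcb⟩
  have hone (a : Fin d → ℤ) : 1 - (halfSpaceSeries a, 1 - halfSpaceSeries a) =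
      (1 - halfSpaceSeries a, halfSpaceSeries a) := Prod.ext rfl (sub_sub_cancel _ _)
  simp only [prod_mk_prod] at hM ⊢
  refine prod_mem_of_prod_sdiff_mul_prod_one_sub_eq_zero M _ hNS hM ?_
  simp only [hone, ← prod_mk_prod]
  exact Prod.ext hPN ((mul_comm _ _).trans hNP)

theorem prod_halfSpaceSeries_mem_reciprocalPairs {W : Type*} [AddCommGroup W] [LinearOrder W]
    [IsOrderedAddMonoid W] {S : Finset (Fin d → ℤ)} {ψ : (Fin d → ℤ) →+ W}
    (hψ : ∀ a ∈ S, 0 < ψ a) :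
    (∏ a ∈ S, halfSpaceSeries a, ∏ a ∈ S, (1 - halfSpaceSeries a)) ∈ reciprocalPairs d := by
  induction S using Finset.strongInduction with
  | H S ih =>
    obtain hcard | hcard := le_or_gt S.card d
    · exact prod_halfSpaceSeries_mem_reciprocalPairs_of_card_le hcard
    obtain ⟨c, hc, hne⟩ := Module.exists_nontrivial_relation_of_finrank_lt_card
      (R := ℤ) (M := Fin d → ℤ) (t := S) (by simpa using hcard)
    have hneg : ∃ a ∈ S, c a < 0 := exists_neg_of_sum_zsmul_eq_zero hψ hc hne
    have hpos : ∃ a ∈ S, 0 < c a := by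
      simpa using exists_neg_of_sum_zsmul_eq_zero (c := -c) hψ (by simpa using hc)
        (by simpa using hne)
    exact prod_halfSpaceSeries_mem_of_sum_zsmul_eq_zero _ hc hneg hpos fun T hT =>
      ih T hT fun a ha => hψ a (hT.subset ha)

end HalfSpace

section RationalCone

variable {m d : ℕ}

/-- The evaluation at a real point `r`, as a homomorphism from integral linear forms. -/
def evalForm (r : Fin d → ℝ) : (Fin d → ℤ) →+ ℝ where
  toFun a := (Int.cast ∘ a) ⬝ᵥ r
  map_zero' := by simp [dotProduct]
  map_add' a a' := by simp [dotProduct, add_mul, Finset.sum_add_distrib]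

lemma evalForm_intCast (x a : Fin d → ℤ) :
    evalForm (fun k => (x k : ℝ)) a = ((a ⬝ᵥ x : ℤ) : ℝ) := by
  simp [evalForm, dotProduct]

lemma continuous_evalForm (a : Fin d → ℤ) : Continuous fun r => evalForm r a := by
  change Continuous fun r : Fin d → ℝ => (Int.cast ∘ a) ⬝ᵥ r
  fun_prop

lemma isOpenMap_evalForm {a : Fin d → ℤ} (ha : a ≠ 0) : IsOpenMap fun r => evalForm r a := by
  obtain ⟨k, hk⟩ := Function.ne_iff.1 ha
  let ℓ : (Fin d → ℝ) →ₗ[ℝ] ℝ := dotProductBilin ℝ ℝ (Int.cast ∘ a)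
  have hℓ : ℓ ≠ 0 := fun h => hk (by simpa [ℓ] using congrArg (· (Pi.single k 1)) h)
  exact ℓ.isOpenMap_of_finiteDimensional (LinearMap.surjective hℓ)

lemma rationalCone_eq_iInter (A : Matrix (Fin m) (Fin d) ℤ) :
    rationalCone A = ⋂ i, {r | evalForm r (A i) ≤ 0} := by
  ext r
  simp only [Set.mem_iInter]
  rfl

lemma intCast_mem_rationalCone {A : Matrix (Fin m) (Fin d) ℤ} {x : Fin d → ℤ} :
    (fun k => (x k : ℝ)) ∈ rationalCone A ↔ ∀ i, A i ⬝ᵥ x ≤ 0 := by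
  simp [rationalCone_eq_iInter, evalForm_intCast]

lemma mem_interior_rationalCone {A : Matrix (Fin m) (Fin d) ℤ} {r : Fin d → ℝ} :
    r ∈ interior (rationalCone A) ↔ ∀ i, A i ≠ 0 → evalForm r (A i) < 0 := by
  rw [rationalCone_eq_iInter, interior_iInter_of_finite, Set.mem_iInter]
  refine forall_congr' fun i => ?_
  by_cases hi : A i = 0
  · simp [hi]
  · change r ∈ interior ((fun r => evalForm r (A i)) ⁻¹' Set.Iic 0) ↔ _
    rw [← (isOpenMap_evalForm hi).preimage_interior_eq_interior_preimage (continuous_evalForm _)]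
    simp [hi]

lemma convex_rationalCone (A : Matrix (Fin m) (Fin d) ℤ) : Convex ℝ (rationalCone A) := by
  rw [rationalCone_eq_iInter]
  exact convex_iInter fun i =>
    convex_halfSpace_le (dotProductBilin ℝ ℝ (Int.cast ∘ A i)).isLinear 0

lemma interior_rationalCone_nonempty {A : Matrix (Fin m) (Fin d) ℤ}
    (hdim : Module.finrank ℝ (Submodule.span ℝ (rationalCone A)) = d) :
    (interior (rationalCone A)).Nonempty := by
  have hzero : 0 ∈ rationalCone A := by simp [rationalCone]
  rw [(convex_rationalCone A).interior_nonempty_iff_affineSpan_eq_top,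
    AffineSubspace.affineSpan_eq_top_iff_vectorSpan_eq_top_of_nonempty _ _ _ ⟨0, hzero⟩,
    vectorSpan_eq_span_vsub_set_right ℝ hzero]
  simp only [vsub_eq_sub, sub_zero, Set.image_id']
  exact Submodule.eq_top_of_finrank_eq (by simpa using hdim)

/-- The nonzero integral forms `a = -A i`, which cut out the cone by the inequalities `0 ≤ a` and
its interior by `0 < a`. -/
def definingForms (A : Matrix (Fin m) (Fin d) ℤ) : Finset (Fin d → ℤ) :=
  (Finset.univ.image fun i => -A i).erase 0

lemma forall_mem_definingForms {A : Matrix (Fin m) (Fin d) ℤ} {P : (Fin d → ℤ) → Prop} :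
    (∀ a ∈ definingForms A, P a) ↔ ∀ i, A i ≠ 0 → P (-A i) := by
  simp only [definingForms, Finset.mem_erase, Finset.mem_image]
  aesop

lemma latticeSeries_rationalCone (A : Matrix (Fin m) (Fin d) ℤ) :
    latticeSeries (rationalCone A) = ∏ a ∈ definingForms A, halfSpaceSeries a := by
  rw [prod_halfSpaceSeries, latticeSeries]
  congr! 1
  ext x
  simp only [Set.mem_ofPred_eq, intCast_mem_rationalCone, forall_mem_definingForms, neg_dotProduct,
    neg_nonneg]
  refine forall_congr' fun i => ⟨fun h _ => h, fun h => ?_⟩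
  by_cases hi : A i = 0
  · simp [hi]
  · exact h hi

lemma latticeSeries_interior_rationalCone_comp_neg (A : Matrix (Fin m) (Fin d) ℤ) :
    (fun x => latticeSeries (interior (rationalCone A)) (-x)) =
      ∏ a ∈ definingForms A, (1 - halfSpaceSeries a) := by
  rw [prod_one_sub_halfSpaceSeries]
  ext x
  have hmem : (fun k => ((-x) k : ℝ)) ∈ interior (rationalCone A) ↔
      ∀ a ∈ definingForms A, a ⬝ᵥ x < 0 := by
    simp only [mem_interior_rationalCone, forall_mem_definingForms, evalForm_intCast,
      Int.cast_lt_zero, dotProduct_neg, neg_dotProduct]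
  exact Set.indicator_eq_indicator hmem rfl

theorem latticeSeries_mem_reciprocalPairs {A : Matrix (Fin m) (Fin d) ℤ}
    (hA : (interior (rationalCone A)).Nonempty) :
    (latticeSeries (rationalCone A), fun x => latticeSeries (interior (rationalCone A)) (-x)) ∈
      reciprocalPairs d := by
  obtain ⟨w, hw⟩ := hA
  rw [latticeSeries_rationalCone, latticeSeries_interior_rationalCone_comp_neg]
  refine prod_halfSpaceSeries_mem_reciprocalPairs (ψ := evalForm w) (forall_mem_definingForms.2 ?_)
  simpa using mem_interior_rationalCone.1 hw

end RationalCone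

end StanleyReciprocity

theorem theorem1_general {m d : ℕ} (A : Matrix (Fin m) (Fin d) ℤ)
    (hdim : Module.finrank ℝ (Submodule.span ℝ (StanleyReciprocity.rationalCone A)) = d) :
    (∃! F : StanleyReciprocity.RationalFunction d,
      StanleyReciprocity.IsExpansionOf
        (StanleyReciprocity.latticeSeries (StanleyReciprocity.rationalCone A)) F) ∧
    (∃! G : StanleyReciprocity.RationalFunction d,
      StanleyReciprocity.IsExpansionOf
        (StanleyReciprocity.latticeSeries (interior (StanleyReciprocity.rationalCone A))) G) ∧
    ∀ F G : StanleyReciprocity.RationalFunction d,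
      StanleyReciprocity.IsExpansionOf
        (StanleyReciprocity.latticeSeries (StanleyReciprocity.rationalCone A)) F →
      StanleyReciprocity.IsExpansionOf
        (StanleyReciprocity.latticeSeries (interior (StanleyReciprocity.rationalCone A))) G →
      F = (-1) ^ d * StanleyReciprocity.RationalFunction.invVars d G := by
  obtain ⟨F₀, hF₀, hG₀⟩ := StanleyReciprocity.latticeSeries_mem_reciprocalPairs
    (StanleyReciprocity.interior_rationalCone_nonempty hdim)
  refine ⟨⟨F₀, hF₀, fun F hF => hF.unique hF₀⟩, ?_, fun F G hF hG => ?_⟩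
  · have hG₁ := hG₀.comp_neg
    simp only [neg_neg] at hG₁
    exact ⟨_, hG₁, fun G hG => hG.unique hG₁⟩
  · rw [hG.comp_neg.unique hG₀, hF.unique hF₀, ← mul_assoc, ← mul_pow, neg_one_mul, neg_neg,
      one_pow, one_mul]

theorem theorem1 {m d : ℕ} (A : Matrix (Fin m) (Fin d) ℤ)
    (hdim : Module.finrank ℝ (Submodule.span ℝ (StanleyReciprocity.rationalCone A)) = d)
    (hpointed : StanleyReciprocity.ContainsNoLine (StanleyReciprocity.rationalCone A)) :
    (∃! F : StanleyReciprocity.RationalFunction d,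
      StanleyReciprocity.IsExpansionOf
        (StanleyReciprocity.latticeSeries (StanleyReciprocity.rationalCone A)) F) ∧
    (∃! G : StanleyReciprocity.RationalFunction d,
      StanleyReciprocity.IsExpansionOf
        (StanleyReciprocity.latticeSeries (interior (StanleyReciprocity.rationalCone A))) G) ∧
    ∀ F G : StanleyReciprocity.RationalFunction d,
      StanleyReciprocity.IsExpansionOf
        (StanleyReciprocity.latticeSeries (StanleyReciprocity.rationalCone A)) F →
      StanleyReciprocity.IsExpansionOf
        (StanleyReciprocity.latticeSeries (interior (StanleyReciprocity.rationalCone A))) G →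
      F = (-1) ^ d * StanleyReciprocity.RationalFunction.invVars d G :=
  theorem1_general A hdim
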